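/- Let $\mu:\mathbb R\to\mathbb R$ be a smooth $2\pi$-periodic function (a mass-aspect function on $S^1=\mathbb R/2\pi\mathbb Z$). An asymptotic symmetry is a smooth $f:\mathbb R\to\mathbb R$ with $f'>0$ and $f(x+2\pi)=f(x)+2\pi$ (a lifted orientation-preserving diffeomorphism of $S^1$); it transforms $\mu$ to $\mu_f=(f')^2\,\mu\circ f-2S(f)$, where $S(f)=\frac{f'''}{f'}-\frac32\big(\frac{f''}{f'}\big)^2$. A Hill function is a solution $\psi:\mathbb R\to\mathbb R$ of $\psi''=\frac{\mu}{4}\psi$. Let $\mathbf M\in\mathbb R^{2\times2}$ be the monodromy matrix of a pair $(\psi_1,\psi_2)$ of Hill functions with $\psi_1'\psi_2-\psi_2'\psi_1=1$, i.e. $(\psi_1,\psi_2)^T(x+2\pi)=\mathbf M\,(\psi_1,\psi_2)^T(x)$ for all $x$. Call $\mathbf M$ elliptic if $\mathbf M=\pm\mathbb I$ or $|\operatorname{tr}\mathbf M|<2$. A half-closed interval of length $2\pi$ is one of the form $[a,a+2\pi)$ or $(a,a+2\pi]$, $a\in\mathbb R$. Theorem. The following are equivalent: (1) $\mu$ can be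 transformed to a constant by an asymptotic symmetry, i.e. $\mu_f$ is constant for some asymptotic symmetry $f$; (2) $\mathbf M$ is elliptic, or there exists a Hill function which has no zeros on any half-closed interval of length $2\pi$; (3) $\mathbf M$ is elliptic, or on each half-closed interval $I$ of length $2\pi$ there is a Hill function (possibly depending on $I$) without zeros on $I$; (4) $\mathbf M$ is elliptic, or $\operatorname{tr}\mathbf M>0$ and there exist a half-closed interval $I$ of length $2\pi$ and a Hill function without zeros on $I$. -/

import Mathlib

open scoped ContDiff

/-- A mass-aspect function on the circle: a smooth real function on `S¹ = ℝ / 2πℤ`,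
identified with its `2π`-periodic lift to `ℝ`. -/
structure IsMassAspect (μ : ℝ → ℝ) : Prop where
  smooth : ContDiff ℝ ∞ μ
  periodic : Function.Periodic μ (2 * Real.pi)

/-- (The lift to `ℝ` of) an orientation-preserving diffeomorphism of the circle: smooth, with
positive derivative, increasing by `2π` after a rotation by `2π`. -/
structure IsCircleDiffeo (f : ℝ → ℝ) : Prop where
  smooth : ContDiff ℝ ∞ f
  deriv_pos : ∀ x, 0 < deriv f x
  map_add : ∀ x, f (x + 2 * Real.pi) = f x + 2 * Real.pi

/-- The Schwarzian derivative `f''' / f' - (3/2) (f'' / f')²`. -/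
noncomputable def schwarzian (f : ℝ → ℝ) (x : ℝ) : ℝ :=
  iteratedDeriv 3 f x / deriv f x - 3 / 2 * (iteratedDeriv 2 f x / deriv f x) ^ 2

/-- The action of an asymptotic symmetry `f` on a mass-aspect function `μ`:
`μ_f = (f')² μ ∘ f - 2 S(f)`. -/
noncomputable def transformedMassAspect (μ f : ℝ → ℝ) (x : ℝ) : ℝ :=
  deriv f x ^ 2 * μ (f x) - 2 * schwarzian f x

/-- `μ` can be transformed to a constant by an asymptotic symmetry. -/
def TransformsToConstant (μ : ℝ → ℝ) : Prop :=
  ∃ f : ℝ → ℝ, IsCircleDiffeo f ∧ ∃ c : ℝ, ∀ x, transformedMassAspect μ f x = c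

/-- `ψ` is a (classical, real, globally defined) solution of the Hill equation
`ψ'' = (μ / 4) ψ`. -/
structure IsHillSolution (μ ψ : ℝ → ℝ) : Prop where
  differentiable : Differentiable ℝ ψ
  hasDerivAt_deriv : ∀ x, HasDerivAt (deriv ψ) (μ x / 4 * ψ x) x

/-- A Wronskian-normalised pair of solutions of the Hill equation:
`ψ₁' ψ₂ - ψ₂' ψ₁ = 1`. -/
structure IsHillBasis (μ ψ₁ ψ₂ : ℝ → ℝ) : Prop where
  fst : IsHillSolution μ ψ₁
  snd : IsHillSolution μ ψ₂
  wronskian : ∀ x, deriv ψ₁ x * ψ₂ x - deriv ψ₂ x * ψ₁ x = 1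

/-- `M` is the monodromy matrix of the Hill equation with respect to some Wronskian-normalised
pair of solutions: `(ψ₁(x + 2π), ψ₂(x + 2π))ᵀ = M (ψ₁(x), ψ₂(x))ᵀ` for all `x`. -/
def IsMonodromyMatrix (μ : ℝ → ℝ) (M : Matrix (Fin 2) (Fin 2) ℝ) : Prop :=
  ∃ ψ₁ ψ₂ : ℝ → ℝ, IsHillBasis μ ψ₁ ψ₂ ∧
    ∀ x, ![ψ₁ (x + 2 * Real.pi), ψ₂ (x + 2 * Real.pi)] = M.mulVec ![ψ₁ x, ψ₂ x]

/-- Ellipticity of a `2 × 2` real matrix of determinant one: `M = ± 1` or `|tr M| < 2`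
(the latter says that `M` has two distinct non-real eigenvalues). -/
def IsEllipticMatrix (M : Matrix (Fin 2) (Fin 2) ℝ) : Prop :=
  M = 1 ∨ M = -1 ∨ |M.trace| < 2

/-- Half-closed intervals of length `2π`: closed from the left or from the right, but not
both. -/
def IsHalfClosedPeriod (I : Set ℝ) : Prop :=
  ∃ a : ℝ, I = Set.Ico a (a + 2 * Real.pi) ∨ I = Set.Ioc a (a + 2 * Real.pi)

/-- `ψ` has no zeros on `I`. -/
def NoZerosOn (ψ : ℝ → ℝ) (I : Set ℝ) : Prop :=
  ∀ x ∈ I, ψ x ≠ 0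

/-!
The proof rests on a real-valued function that encodes a normalising diffeomorphism. If `u` is
smooth, positive and `2π`-periodic and `2 u u'' - u'² - μ u² = K` is constant, then the solution
`f` of `f' = u ∘ f / κ`, with `κ` chosen so that `f (x + 2π) = f x + 2π`, satisfies
`μ_f = -K / κ²` (`transformsToConstant_of_periodic`). Every quadratic form in a normalised pair
`v = (ψ₁, ψ₂)` of Hill functions has this property apart from positivity and periodicity
(`IsHillBasis.transformsToConstant_of_quadratic`).

For `M = ± 1` the form `ψ₁² + ψ₂²` is positive and periodic. In general
`W(x) = det (v(x), v(x + 2π)) = det (v(x), M v(x))` is a periodic quadratic form, since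
`det M = 1`; if it has no zero then `W` or `-W` is admissible. A zero `x₀` of `W` says that `v(x₀)`
is an eigenvector of `M`, and then the Hill function `φ(x) = det (v(x), v(x₀))`, which vanishes at
`x₀`, is multiplicative: `φ(x + 2π) = l φ(x)` with `l + 1 / l = tr M`
(`IsHillBasis.exists_multiplicative`). This is impossible if `|tr M| < 2`. Since `φ` vanishes at
both ends of `[x₀, x₀ + 2π)`, Sturm separation (`IsHillSolution.exists_zero_between`) shows that no
Hill function is zero-free there, which excludes it under condition (3). If `tr M > 0` then
`l > 0`, so `φ'` has the same sign at `x₀` and `x₀ + 2π` and `φ` has another zero in between; thus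
every half-closed period contains two zeros of `φ`, hence a zero of every Hill function
(`IsHillSolution.exists_zero_mem_of_multiplier_pos`), which excludes it under condition (4).

Conversely, `ψ ↦ (f')^{-1/2} ψ ∘ f` carries solutions for `μ` to solutions for `μ_f` and preserves
Wronskians, monodromy and zero-freeness (`IsHillSolution.transport`, `IsHillBasis.transport`). When
`μ_f = C` is constant the equation is solved explicitly: for `C < 0` the monodromy is conjugate to
a rotation, so elliptic, and for `C ≥ 0` an exponential (a constant if `C = 0`) has no zeros.
Finally, a zero-free Hill function forces `tr M > 0` by the Cayley–Hamilton relation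
`ψ(x + 4π) + ψ(x) = (tr M) ψ(x + 2π)`.
-/

/-! ### Solutions of the Hill equation -/

namespace IsHillSolution

variable {μ φ ψ : ℝ → ℝ}

theorem hasDerivAt (h : IsHillSolution μ ψ) (x : ℝ) : HasDerivAt ψ (deriv ψ x) x :=
  (h.differentiable x).hasDerivAt

theorem of_hasDerivAt {ψ' : ℝ → ℝ} (h : ∀ x, HasDerivAt ψ (ψ' x) x)
    (h' : ∀ x, HasDerivAt ψ' (μ x / 4 * ψ x) x) : IsHillSolution μ ψ := by
  have hd : deriv ψ = ψ' := funext fun x => (h x).deriv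
  exact ⟨fun x => (h x).differentiableAt, fun x => hd ▸ h' x⟩

theorem deriv_combination (hφ : IsHillSolution μ φ) (hψ : IsHillSolution μ ψ) (p q x : ℝ) :
    deriv (fun x => p * φ x + q * ψ x) x = p * deriv φ x + q * deriv ψ x :=
  (((hφ.hasDerivAt x).const_mul p).add ((hψ.hasDerivAt x).const_mul q)).deriv

theorem combination (hφ : IsHillSolution μ φ) (hψ : IsHillSolution μ ψ) (p q : ℝ) :
    IsHillSolution μ (fun x => p * φ x + q * ψ x) :=
  of_hasDerivAt
    (fun x => ((hφ.hasDerivAt x).const_mul p).add ((hψ.hasDerivAt x).const_mul q))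
    (fun x => (((hφ.hasDerivAt_deriv x).const_mul p).add
      ((hψ.hasDerivAt_deriv x).const_mul q)).congr_deriv (by ring))

theorem contDiff (hμ : ContDiff ℝ ∞ μ) (h : IsHillSolution μ ψ) : ContDiff ℝ ∞ ψ := by
  have hdd : deriv (deriv ψ) = fun x => μ x / 4 * ψ x :=
    funext fun x => (h.hasDerivAt_deriv x).deriv
  have key : ∀ n : ℕ, ContDiff ℝ n ψ ∧ ContDiff ℝ n (deriv ψ) := by
    intro n
    induction n with
    | zero =>
      exact ⟨contDiff_zero.2 h.differentiable.continuous, contDiff_zero.2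
        (continuous_iff_continuousAt.2 fun x => (h.hasDerivAt_deriv x).continuousAt)⟩
    | succ n ih =>
      have hμn : ContDiff ℝ n μ := hμ.of_le (by exact_mod_cast le_top)
      refine ⟨?_, ?_⟩
      · push_cast
        exact contDiff_succ_iff_deriv.2 ⟨h.differentiable, by simp, ih.2⟩
      · push_cast
        refine contDiff_succ_iff_deriv.2
          ⟨fun x => (h.hasDerivAt_deriv x).differentiableAt, by simp, ?_⟩
        rw [hdd]
        exact (hμn.div_const 4).mul ih.1
  exact contDiff_infty.2 fun n => (key n).1

theorem wronskian_eq (hφ : IsHillSolution μ φ) (hψ : IsHillSolution μ ψ) (x y : ℝ) :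
    deriv φ x * ψ x - deriv ψ x * φ x = deriv φ y * ψ y - deriv ψ y * φ y := by
  have hd : ∀ x, HasDerivAt (fun x => deriv φ x * ψ x - deriv ψ x * φ x) 0 x := fun x =>
    (((hφ.hasDerivAt_deriv x).mul (hψ.hasDerivAt x)).sub
      ((hψ.hasDerivAt_deriv x).mul (hφ.hasDerivAt x))).congr_deriv (by ring)
  exact is_const_of_deriv_eq_zero (fun x => (hd x).differentiableAt) (fun x => (hd x).deriv) x y

/-- Sturm separation: were `ψ` zero-free on `[a, b)`, the nonzero Wronskian would make it
nonzero at `b` as well, and `φ / ψ` would be strictly monotone with equal values at `a`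
and `b`. -/
theorem exists_zero_between (hφ : IsHillSolution μ φ) (hψ : IsHillSolution μ ψ) {a b : ℝ}
    (hab : a < b) (ha : φ a = 0) (hb : φ b = 0) (ha' : deriv φ a ≠ 0) :
    ∃ x ∈ Set.Ico a b, ψ x = 0 := by
  by_contra! hne
  set w := deriv φ a * ψ a - deriv ψ a * φ a with hw
  have hwx : ∀ x, deriv φ x * ψ x - deriv ψ x * φ x = w := fun x => hφ.wronskian_eq hψ x a
  have hw0 : w ≠ 0 := by
    rw [hw, ha, mul_zero, sub_zero]
    exact mul_ne_zero ha' (hne a ⟨le_rfl, hab⟩)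
  have hψ0 : ∀ x ∈ Set.Icc a b, ψ x ≠ 0 := by
    intro x hx h0
    rcases hx.2.lt_or_eq with hlt | rfl
    · exact hne x ⟨hx.1, hlt⟩ h0
    · exact hw0 (by rw [← hwx x, h0, hb]; ring)
  have hder : ∀ x ∈ Set.Icc a b, HasDerivAt (fun x => φ x / ψ x)
      ((deriv φ x * ψ x - φ x * deriv ψ x) / ψ x ^ 2) x := fun x hx =>
    (hφ.hasDerivAt x).div (hψ.hasDerivAt x) (hψ0 x hx)
  obtain ⟨x, hx, hx0⟩ := exists_hasDerivAt_eq_zero hab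
    (fun x hx => (hder x hx).continuousAt.continuousWithinAt) (by simp [ha, hb])
    (fun x hx => hder x (Set.Ioo_subset_Icc_self hx))
  have hψx := hψ0 x (Set.Ioo_subset_Icc_self hx)
  rw [div_eq_zero_iff] at hx0
  rcases hx0 with h | h
  · exact hw0 (by rw [← hwx x]; linarith)
  · exact hψx (pow_eq_zero_iff two_ne_zero |>.1 h)

end IsHillSolution

/-- The Wronskians with `ψ₁` and `ψ₂` are the coordinates of a solution in the basis. -/
theorem IsHillBasis.exists_combination {μ ψ₁ ψ₂ φ : ℝ → ℝ} (h : IsHillBasis μ ψ₁ ψ₂)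
    (hφ : IsHillSolution μ φ) : ∃ p q : ℝ, ∀ x, φ x = p * ψ₁ x + q * ψ₂ x := by
  refine ⟨deriv φ 0 * ψ₂ 0 - deriv ψ₂ 0 * φ 0, -(deriv φ 0 * ψ₁ 0 - deriv ψ₁ 0 * φ 0), ?_⟩
  intro x
  rw [hφ.wronskian_eq h.snd 0 x, hφ.wronskian_eq h.fst 0 x]
  linear_combination (-φ x) * h.wronskian x

/-! ### Existence of a normalising diffeomorphism -/

theorem surjective_of_continuous_of_map_add {f : ℝ → ℝ} {T : ℝ} (hT : 0 < T)
    (hf : Continuous f) (hadd : ∀ x, f (x + T) = f x + T) : Function.Surjective f := by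
  have h : ∀ n : ℕ, f (n * T) = f 0 + n * T ∧ f (-(n * T)) = f 0 - n * T := by
    intro n
    induction n with
    | zero => simp
    | succ n ih =>
      have h1 := hadd (n * T)
      have h2 := hadd (-((n + 1 : ℝ) * T))
      rw [show -((n + 1 : ℝ) * T) + T = -(n * T) by ring, ih.2] at h2
      rw [show (n : ℝ) * T + T = (n + 1 : ℝ) * T by ring, ih.1] at h1
      push_cast
      constructor <;> linarith
  intro y
  obtain ⟨n, hn⟩ := exists_nat_ge (|y - f 0| / T)
  rw [div_le_iff₀ hT] at hn
  have hy := abs_le.1 hn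
  exact mem_range_of_exists_le_of_exists_ge hf
    ⟨_, (h n).2.le.trans (by linarith)⟩ ⟨_, (by linarith : y ≤ _).trans (h n).1.ge⟩

/-- The inverse `f` of a primitive of `κ / u`, where `κ` normalises the total increase over a
period to `2π`, satisfies the autonomous equation `f' = u ∘ f / κ`. -/
theorem exists_circleDiffeo_deriv_eq {u : ℝ → ℝ} (hu : ContDiff ℝ ∞ u) (hpos : ∀ x, 0 < u x)
    (hper : Function.Periodic u (2 * Real.pi)) :
    ∃ (f : ℝ → ℝ) (κ : ℝ), 0 < κ ∧ IsCircleDiffeo f ∧ ∀ y, HasDerivAt f (u (f y) / κ) y := by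
  have hpi : (0 : ℝ) < 2 * Real.pi := Real.two_pi_pos
  have hc : Continuous fun x => (u x)⁻¹ := hu.continuous.inv₀ fun x => (hpos x).ne'
  have hint : ∀ a b, IntervalIntegrable (fun x => (u x)⁻¹) MeasureTheory.volume a b :=
    fun a b => hc.intervalIntegrable a b
  set α := ∫ x in (0 : ℝ)..(2 * Real.pi), (u x)⁻¹ with hα
  have hαpos : 0 < α := intervalIntegral.intervalIntegral_pos_of_pos (hint _ _)
    (fun x => inv_pos.2 (hpos x)) hpi
  set κ := 2 * Real.pi / α with hκ
  have hκpos : 0 < κ := div_pos hpi hαpos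
  set G : ℝ → ℝ := fun x => κ * ∫ t in (0 : ℝ)..x, (u t)⁻¹ with hG
  have hGd : ∀ x, HasDerivAt G (κ * (u x)⁻¹) x := fun x =>
    (hc.integral_hasStrictDerivAt 0 x).hasDerivAt.const_mul κ
  have hGmono : StrictMono G := strictMono_of_deriv_pos fun x => by
    rw [(hGd x).deriv]; exact mul_pos hκpos (inv_pos.2 (hpos x))
  have hGadd : ∀ x, G (x + 2 * Real.pi) = G x + 2 * Real.pi := by
    intro x
    have hp : Function.Periodic (fun x => (u x)⁻¹) (2 * Real.pi) := fun x => by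
      simp only [hper x]
    have h1 : (∫ t in x..(x + 2 * Real.pi), (u t)⁻¹) = α := by
      rw [hp.intervalIntegral_add_eq x 0, zero_add]
    have h2 := intervalIntegral.integral_add_adjacent_intervals (hint 0 x)
      (hint x (x + 2 * Real.pi))
    have h3 : κ * α = 2 * Real.pi := div_mul_cancel₀ _ hαpos.ne'
    simp only [hG]
    rw [← h2, h1, mul_add, h3]
  have hGc : Continuous G := continuous_iff_continuousAt.2 fun x => (hGd x).continuousAt
  have hsurj := surjective_of_continuous_of_map_add hpi hGc hGadd
  set e := hGmono.orderIsoOfSurjective G hsurj with he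
  set f : ℝ → ℝ := fun y => e.symm y with hf
  have hGf : ∀ y, G (f y) = y := fun y => e.apply_symm_apply y
  have hfc : Continuous f := e.symm.continuous
  have hfd : ∀ y, HasDerivAt f (u (f y) / κ) y := by
    intro y
    have h := HasDerivAt.of_local_left_inverse (f := G) (g := f) (a := y) hfc.continuousAt
      (hGd (f y)) (mul_pos hκpos (inv_pos.2 (hpos _))).ne' (Filter.Eventually.of_forall hGf)
    refine h.congr_deriv ?_
    rw [mul_inv, inv_inv, div_eq_mul_inv, mul_comm]
  have hfderiv : deriv f = fun y => u (f y) / κ := funext fun y => (hfd y).deriv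
  have hfsmooth : ∀ n : ℕ, ContDiff ℝ n f := by
    intro n
    induction n with
    | zero => exact contDiff_zero.2 hfc
    | succ n ih =>
      push_cast
      refine contDiff_succ_iff_deriv.2 ⟨fun y => (hfd y).differentiableAt, by simp, ?_⟩
      rw [hfderiv]
      exact ((hu.of_le (by exact_mod_cast le_top)).comp ih).div_const κ
  refine ⟨f, κ, hκpos, ⟨contDiff_infty.2 hfsmooth, fun y => ?_, fun y => ?_⟩, hfd⟩
  · rw [(hfd y).deriv]; exact div_pos (hpos _) hκpos
  · apply hGmono.injective
    rw [hGadd, hGf, hGf]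

theorem schwarzian_eq_of_hasDerivAt {f f₁ f₂ f₃ : ℝ → ℝ} (h₁ : ∀ x, HasDerivAt f (f₁ x) x)
    (h₂ : ∀ x, HasDerivAt f₁ (f₂ x) x) (h₃ : ∀ x, HasDerivAt f₂ (f₃ x) x) (x : ℝ) :
    schwarzian f x = f₃ x / f₁ x - 3 / 2 * (f₂ x / f₁ x) ^ 2 := by
  have e₁ : deriv f = f₁ := funext fun x => (h₁ x).deriv
  have e₂ : deriv f₁ = f₂ := funext fun x => (h₂ x).deriv
  have e₃ : deriv f₂ = f₃ := funext fun x => (h₃ x).deriv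
  have i₂ : iteratedDeriv 2 f = f₂ := by
    rw [iteratedDeriv_succ, iteratedDeriv_one, e₁, e₂]
  have i₃ : iteratedDeriv 3 f = f₃ := by
    rw [iteratedDeriv_succ, i₂, e₃]
  rw [schwarzian, i₂, i₃, e₁]

/-- If `2 u u'' - u'² - μ u²` is constant then the diffeomorphism solving `f' = u ∘ f / κ`
normalises `μ`, because `S(f) = (u u'' - u'² / 2) ∘ f / κ²`. -/
theorem transformsToConstant_of_periodic {μ u u' u'' : ℝ → ℝ} {K : ℝ} (hu : ContDiff ℝ ∞ u)
    (hpos : ∀ x, 0 < u x) (hper : Function.Periodic u (2 * Real.pi))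
    (hu' : ∀ x, HasDerivAt u (u' x) x) (hu'' : ∀ x, HasDerivAt u' (u'' x) x)
    (hK : ∀ x, 2 * u x * u'' x - u' x ^ 2 - μ x * u x ^ 2 = K) : TransformsToConstant μ := by
  obtain ⟨f, κ, hκ, hf, hfd⟩ := exists_circleDiffeo_deriv_eq hu hpos hper
  refine ⟨f, hf, -K / κ ^ 2, fun x => ?_⟩
  have h₂ : ∀ y, HasDerivAt (fun y => u (f y) / κ) (u' (f y) * (u (f y) / κ) / κ) y := fun y =>
    ((hu' (f y)).comp y (hfd y)).div_const κ
  have h₃ : ∀ y, HasDerivAt (fun y => u' (f y) * (u (f y) / κ) / κ)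
      ((u'' (f y) * (u (f y) / κ) * (u (f y) / κ) +
        u' (f y) * (u' (f y) * (u (f y) / κ) / κ)) / κ) y := fun y =>
    (((hu'' (f y)).comp y (hfd y)).mul (h₂ y)).div_const κ
  have hux := (hpos (f x)).ne'
  rw [transformedMassAspect, schwarzian_eq_of_hasDerivAt hfd h₂ h₃, (hfd x).deriv, ← hK (f x)]
  field_simp
  ring

/-- A positive periodic quadratic form in two normalised Hill functions: the constant
`2 u u'' - u'² - μ u²` is `4 A C - B²`. -/
theorem IsHillBasis.transformsToConstant_of_quadratic {μ ψ₁ ψ₂ : ℝ → ℝ} (hμ : ContDiff ℝ ∞ μ)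
    (h : IsHillBasis μ ψ₁ ψ₂) (A B C : ℝ)
    (hpos : ∀ x, 0 < A * ψ₁ x ^ 2 + B * (ψ₁ x * ψ₂ x) + C * ψ₂ x ^ 2)
    (hper : Function.Periodic (fun x => A * ψ₁ x ^ 2 + B * (ψ₁ x * ψ₂ x) + C * ψ₂ x ^ 2)
      (2 * Real.pi)) : TransformsToConstant μ := by
  have hs₁ := h.fst.contDiff hμ
  have hs₂ := h.snd.contDiff hμ
  refine transformsToConstant_of_periodic (K := 4 * A * C - B ^ 2)
    (u' := fun x => A * (2 * ψ₁ x * deriv ψ₁ x) + B * (deriv ψ₁ x * ψ₂ x + ψ₁ x * deriv ψ₂ x)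
      + C * (2 * ψ₂ x * deriv ψ₂ x))
    (u'' := fun x => A * (2 * (deriv ψ₁ x ^ 2 + ψ₁ x * (μ x / 4 * ψ₁ x)))
      + B * (μ x / 4 * ψ₁ x * ψ₂ x + 2 * deriv ψ₁ x * deriv ψ₂ x + ψ₁ x * (μ x / 4 * ψ₂ x))
      + C * (2 * (deriv ψ₂ x ^ 2 + ψ₂ x * (μ x / 4 * ψ₂ x))))
    (by fun_prop) hpos hper (fun x => ?_) (fun x => ?_) (fun x => ?_)
  · have d₁ := h.fst.hasDerivAt x
    have d₂ := h.snd.hasDerivAt x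
    exact ((((d₁.pow 2).const_mul A).add ((d₁.mul d₂).const_mul B)).add
      ((d₂.pow 2).const_mul C)).congr_deriv (by ring)
  · have d₁ := h.fst.hasDerivAt x
    have d₂ := h.snd.hasDerivAt x
    have e₁ := h.fst.hasDerivAt_deriv x
    have e₂ := h.snd.hasDerivAt_deriv x
    exact (((((d₁.const_mul 2).mul e₁).const_mul A).add
      (((e₁.mul d₂).add (d₁.mul e₂)).const_mul B)).add
      (((d₂.const_mul 2).mul e₂).const_mul C)).congr_deriv (by ring)
  · have hw : (deriv ψ₁ x * ψ₂ x - deriv ψ₂ x * ψ₁ x) ^ 2 = 1 := by rw [h.wronskian x, one_pow]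
    linear_combination (4 * A * C - B ^ 2) * hw

/-! ### Zeros of functions multiplied by a constant under translation -/

/-- A differentiable function with derivatives of the same sign at two consecutive zeros would
have to change sign in between. -/
theorem exists_zero_Ioo_of_deriv_mul_pos {φ : ℝ → ℝ} (hφ : Differentiable ℝ φ) {a b : ℝ}
    (hab : a < b) (ha : φ a = 0) (hb : φ b = 0) (hd : 0 < deriv φ a * deriv φ b) :
    ∃ x ∈ Set.Ioo a b, φ x = 0 := by
  wlog hpos : 0 < deriv φ a generalizing φ
  · have ha0 : deriv φ a ≠ 0 := left_ne_zero_of_mul hd.ne'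
    obtain ⟨x, hx, h0⟩ := this (φ := fun x => -φ x) hφ.neg (by simp [ha]) (by simp [hb])
      (by simpa using hd) (by simpa using lt_of_le_of_ne (not_lt.1 hpos) ha0)
    exact ⟨x, hx, neg_eq_zero.1 h0⟩
  have hposb : 0 < deriv φ b := pos_of_mul_pos_right hd hpos.le
  obtain ⟨y, hy, hys⟩ := ((((hφ a).hasDerivAt.tendsto_slope.mono_left
    (nhdsWithin_mono a (s := Set.Ioi a) fun x hx => ne_of_gt hx)).eventually_const_lt hpos).and
      (Ioo_mem_nhdsGT hab)).exists
  obtain ⟨z, hz, hzs⟩ := ((((hφ b).hasDerivAt.tendsto_slope.mono_left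
    (nhdsWithin_mono b (s := Set.Iio b) fun x hx => ne_of_lt hx)).eventually_const_lt hposb).and
      (Ioo_mem_nhdsLT hab)).exists
  rw [slope_def_field, ha, sub_zero] at hy
  rw [slope_def_field, hb, sub_zero] at hz
  have hy' : 0 < φ y := by
    have := mul_pos hy (sub_pos.2 hys.1)
    rwa [div_mul_cancel₀ _ (sub_pos.2 hys.1).ne'] at this
  have hz' : φ z < 0 := by
    have := mul_neg_of_pos_of_neg hz (sub_neg.2 hzs.2)
    rwa [div_mul_cancel₀ _ (sub_neg.2 hzs.2).ne] at this
  obtain ⟨x, hx, h0⟩ := isPreconnected_Ioo.intermediate_value hzs hys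
    hφ.continuous.continuousOn (show (0 : ℝ) ∈ Set.Icc (φ z) (φ y) from ⟨hz'.le, hy'.le⟩)
  exact ⟨x, hx, h0⟩

theorem zero_add_zsmul_of_translate {φ : ℝ → ℝ} {T l : ℝ} (hl : l ≠ 0)
    (h : ∀ x, φ (x + T) = l * φ x) {x : ℝ} (hx : φ x = 0) (n : ℤ) : φ (x + n • T) = 0 := by
  induction n using Int.induction_on with
  | zero => simpa using hx
  | succ n ih => rw [add_smul, one_smul, ← add_assoc, h, ih, mul_zero]
  | pred n ih =>
    rw [sub_smul, one_smul]
    have := h (x + (-(n : ℤ) • T - T))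
    rw [show x + (-(n : ℤ) • T - T) + T = x + -(n : ℤ) • T by ring, ih] at this
    exact (mul_eq_zero.1 this.symm).resolve_left hl

theorem IsHalfClosedPeriod.exists_add_zsmul_mem {I : Set ℝ} (hI : IsHalfClosedPeriod I) (x : ℝ) :
    ∃ n : ℤ, x + n • (2 * Real.pi) ∈ I := by
  obtain ⟨a, rfl | rfl⟩ := hI
  · exact (existsUnique_add_zsmul_mem_Ico Real.two_pi_pos x a).exists
  · exact (existsUnique_add_zsmul_mem_Ioc Real.two_pi_pos x a).exists

theorem IsHalfClosedPeriod.ordConnected {I : Set ℝ} (hI : IsHalfClosedPeriod I) :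
    I.OrdConnected := by
  obtain ⟨a, rfl | rfl⟩ := hI
  · exact Set.ordConnected_Ico
  · exact Set.ordConnected_Ioc

/-- A multiplicative solution with positive multiplier and a zero has at least two zeros in
every half-closed period, so by Sturm separation no solution is zero-free there. -/
theorem IsHillSolution.exists_zero_mem_of_multiplier_pos {μ φ ψ : ℝ → ℝ}
    (hφ : IsHillSolution μ φ) (hψ : IsHillSolution μ ψ) {l x₀ : ℝ} (hl : 0 < l)
    (h : ∀ x, φ (x + 2 * Real.pi) = l * φ x) (h0 : φ x₀ = 0)
    (hφ0 : ∀ x, φ x = 0 → deriv φ x ≠ 0) {I : Set ℝ}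
    (hI : IsHalfClosedPeriod I) : ∃ x ∈ I, ψ x = 0 := by
  have hpi := Real.two_pi_pos
  have hd : deriv φ (x₀ + 2 * Real.pi) = l * deriv φ x₀ := by
    rw [← deriv_comp_add_const, funext h, deriv_const_mul_field]
  obtain ⟨x₁, hx₁, h1⟩ := exists_zero_Ioo_of_deriv_mul_pos hφ.differentiable
    (a := x₀) (b := x₀ + 2 * Real.pi) (by linarith) h0 (by rw [h, h0, mul_zero])
    (by
      rw [hd, mul_left_comm]
      exact mul_pos hl (mul_self_pos.2 (hφ0 x₀ h0)))
  obtain ⟨m, hm⟩ := hI.exists_add_zsmul_mem x₀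
  obtain ⟨n, hn⟩ := hI.exists_add_zsmul_mem x₁
  have hzm := zero_add_zsmul_of_translate hl.ne' h h0 m
  have hzn := zero_add_zsmul_of_translate hl.ne' h h1 n
  have hne : x₀ + m • (2 * Real.pi) ≠ x₁ + n • (2 * Real.pi) := by
    intro he
    simp only [zsmul_eq_mul] at he
    have h2 : x₁ - x₀ = ((m - n : ℤ) : ℝ) * (2 * Real.pi) := by push_cast; linarith
    have h3 : (0 : ℝ) < ((m - n : ℤ) : ℝ) := by
      refine pos_of_mul_pos_left (b := 2 * Real.pi) ?_ hpi.le
      rw [← h2]; linarith [hx₁.1]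
    have h4 : ((m - n : ℤ) : ℝ) < 1 := by
      refine lt_of_mul_lt_mul_right (a := 2 * Real.pi) ?_ hpi.le
      rw [← h2]; linarith [hx₁.2]
    have h5 : 0 < m - n := by exact_mod_cast h3
    have h6 : m - n < 1 := by exact_mod_cast h4
    omega
  rcases hne.lt_or_gt with hlt | hlt
  · obtain ⟨x, hx, hx0⟩ := hφ.exists_zero_between hψ hlt hzm hzn (hφ0 _ hzm)
    exact ⟨x, hI.ordConnected.out hm hn (Set.Ico_subset_Icc_self hx), hx0⟩
  · obtain ⟨x, hx, hx0⟩ := hφ.exists_zero_between hψ hlt hzn hzm (hφ0 _ hzn)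
    exact ⟨x, hI.ordConnected.out hn hm (Set.Ico_subset_Icc_self hx), hx0⟩

/-! ### The monodromy matrix -/

theorem IsMonodromyMatrix.exists_basis {μ : ℝ → ℝ} {M : Matrix (Fin 2) (Fin 2) ℝ}
    (hM : IsMonodromyMatrix μ M) : ∃ ψ₁ ψ₂ : ℝ → ℝ, IsHillBasis μ ψ₁ ψ₂ ∧
      (∀ x, ψ₁ (x + 2 * Real.pi) = M 0 0 * ψ₁ x + M 0 1 * ψ₂ x) ∧
      ∀ x, ψ₂ (x + 2 * Real.pi) = M 1 0 * ψ₁ x + M 1 1 * ψ₂ x := by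
  obtain ⟨ψ₁, ψ₂, hb, h⟩ := hM
  refine ⟨ψ₁, ψ₂, hb, fun x => ?_, fun x => ?_⟩
  · simpa [Matrix.mulVec, dotProduct, Fin.sum_univ_two] using congrFun (h x) 0
  · simpa [Matrix.mulVec, dotProduct, Fin.sum_univ_two] using congrFun (h x) 1

/-- Liouville: the Wronskian is constant, hence the monodromy is unimodular. -/
theorem IsHillBasis.monodromy_det {μ ψ₁ ψ₂ : ℝ → ℝ} (hb : IsHillBasis μ ψ₁ ψ₂)
    {T a b c d : ℝ} (h₁ : ∀ x, ψ₁ (x + T) = a * ψ₁ x + b * ψ₂ x)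
    (h₂ : ∀ x, ψ₂ (x + T) = c * ψ₁ x + d * ψ₂ x) : a * d - b * c = 1 := by
  have e₁ : deriv ψ₁ (0 + T) = a * deriv ψ₁ 0 + b * deriv ψ₂ 0 := by
    rw [← deriv_comp_add_const, funext h₁, hb.fst.deriv_combination hb.snd]
  have e₂ : deriv ψ₂ (0 + T) = c * deriv ψ₁ 0 + d * deriv ψ₂ 0 := by
    rw [← deriv_comp_add_const, funext h₂, hb.fst.deriv_combination hb.snd]
  have hw := hb.wronskian (0 + T)
  rw [e₁, e₂, h₁, h₂] at hw
  linear_combination hw - (a * d - b * c) * hb.wronskian 0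

/-- Cayley–Hamilton for the translation by `T` on the space of solutions. -/
theorem IsHillBasis.translate_twice {μ ψ₁ ψ₂ φ : ℝ → ℝ} (hb : IsHillBasis μ ψ₁ ψ₂)
    {T a b c d : ℝ} (h₁ : ∀ x, ψ₁ (x + T) = a * ψ₁ x + b * ψ₂ x)
    (h₂ : ∀ x, ψ₂ (x + T) = c * ψ₁ x + d * ψ₂ x) (hφ : IsHillSolution μ φ) (x : ℝ) :
    φ (x + T + T) + φ x = (a + d) * φ (x + T) := by
  have hdet := hb.monodromy_det h₁ h₂
  obtain ⟨p, q, hpq⟩ := hb.exists_combination hφ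
  simp only [hpq, h₁, h₂]
  linear_combination (-(p * ψ₁ x) - q * ψ₂ x) * hdet

/-- The solution vanishing at a zero of the invariant form
`det (v, M v) = c v₁² + (d - a) v₁ v₂ - b v₂²` is multiplicative: `v(x₀)` is then an
eigenvector of `M`, and `x ↦ det (v(x), v(x₀))` is the required solution. -/
theorem IsHillBasis.exists_multiplicative {μ ψ₁ ψ₂ : ℝ → ℝ} (hb : IsHillBasis μ ψ₁ ψ₂)
    {T a b c d x₀ : ℝ} (h₁ : ∀ x, ψ₁ (x + T) = a * ψ₁ x + b * ψ₂ x)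
    (h₂ : ∀ x, ψ₂ (x + T) = c * ψ₁ x + d * ψ₂ x)
    (h0 : c * ψ₁ x₀ ^ 2 + (d - a) * (ψ₁ x₀ * ψ₂ x₀) - b * ψ₂ x₀ ^ 2 = 0) :
    ∃ (φ : ℝ → ℝ) (l : ℝ), IsHillSolution μ φ ∧ φ x₀ = 0 ∧ (∀ x, φ x = 0 → deriv φ x ≠ 0) ∧
      (∀ x, φ (x + T) = l * φ x) ∧ l * (a + d) = l ^ 2 + 1 := by
  set p := ψ₁ x₀ with hp
  set q := ψ₂ x₀ with hq
  have hφ : IsHillSolution μ (fun x => q * ψ₁ x + -p * ψ₂ x) :=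
    hb.fst.combination hb.snd q (-p)
  have hdet := hb.monodromy_det h₁ h₂
  have hpq : ¬(p = 0 ∧ q = 0) := by
    rintro ⟨h, h'⟩
    have := hb.wronskian x₀
    rw [← hp, ← hq, h, h'] at this
    simp at this
  have hφ0 : ∀ x, q * ψ₁ x + -p * ψ₂ x = 0 →
      deriv (fun x => q * ψ₁ x + -p * ψ₂ x) x ≠ 0 := by
    intro x hx hx'
    rw [hb.fst.deriv_combination hb.snd] at hx'
    have hw := hb.wronskian x
    refine hpq ⟨?_, ?_⟩
    · linear_combination ψ₁ x * hx' - deriv ψ₁ x * hx - p * hw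
    · linear_combination ψ₂ x * hx' - deriv ψ₂ x * hx - q * hw
  set φ : ℝ → ℝ := fun x => q * ψ₁ x + -p * ψ₂ x with hφdef
  have hφx : φ x₀ = 0 := by simp only [hφdef, ← hp, ← hq]; ring
  -- `l` is the other eigenvalue `d - b q / p` of `M`, which is `a` when `p = 0`
  obtain ⟨l, hl⟩ : ∃ l : ℝ, ∀ x, φ (x + T) = l * φ x := by
    by_cases hp0 : p = 0
    · have hq0 : q ≠ 0 := fun h => hpq ⟨hp0, h⟩
      have hb0 : b = 0 := by
        rw [hp0] at h0
        have : b * q ^ 2 = 0 := by linarith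
        exact (mul_eq_zero.1 this).resolve_right (pow_ne_zero 2 hq0)
      refine ⟨a, fun x => ?_⟩
      simp only [hφdef, h₁, h₂, hp0, hb0]
      ring
    · refine ⟨(d * p - b * q) / p, fun x => ?_⟩
      simp only [hφdef, h₁, h₂]
      field_simp
      linear_combination (-ψ₁ x) * h0
  refine ⟨φ, l, hφ, hφx, hφ0, hl, ?_⟩
  -- `φ' (x₀) ≠ 0`, so `φ` takes a nonzero value, at which Cayley–Hamilton can be evaluated
  obtain ⟨y, hy⟩ : ∃ y, φ y ≠ 0 := by
    by_contra! hall
    exact hφ0 x₀ hφx (by rw [funext hall]; simp)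
  have := hb.translate_twice h₁ h₂ hφ y
  rw [hl, hl] at this
  exact mul_right_cancel₀ hy (by linear_combination -this)

/-- If the invariant form `det (v, M v)` has no zero along `v = (ψ₁, ψ₂)`, it is up to sign a
positive periodic quadratic form in the solutions; each zero of it yields a multiplicative
solution with a zero. -/
theorem IsHillBasis.transformsToConstant_or_multiplicative {μ ψ₁ ψ₂ : ℝ → ℝ}
    (hμ : ContDiff ℝ ∞ μ) (hb : IsHillBasis μ ψ₁ ψ₂) {a b c d : ℝ}
    (h₁ : ∀ x, ψ₁ (x + 2 * Real.pi) = a * ψ₁ x + b * ψ₂ x)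
    (h₂ : ∀ x, ψ₂ (x + 2 * Real.pi) = c * ψ₁ x + d * ψ₂ x) :
    TransformsToConstant μ ∨ ∃ (φ : ℝ → ℝ) (l x₀ : ℝ), IsHillSolution μ φ ∧ φ x₀ = 0 ∧
      (∀ x, φ x = 0 → deriv φ x ≠ 0) ∧ (∀ x, φ (x + 2 * Real.pi) = l * φ x) ∧
      l * (a + d) = l ^ 2 + 1 := by
  have hdet := hb.monodromy_det h₁ h₂
  by_cases hW : ∃ x₀, c * ψ₁ x₀ ^ 2 + (d - a) * (ψ₁ x₀ * ψ₂ x₀) - b * ψ₂ x₀ ^ 2 = 0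
  · obtain ⟨x₀, h0⟩ := hW
    obtain ⟨φ, l, h⟩ := hb.exists_multiplicative h₁ h₂ h0
    exact Or.inr ⟨φ, l, x₀, h⟩
  refine Or.inl ?_
  push Not at hW
  set W : ℝ → ℝ := fun x => c * ψ₁ x ^ 2 + (d - a) * (ψ₁ x * ψ₂ x) - b * ψ₂ x ^ 2 with hWdef
  have hWper : ∀ x, W (x + 2 * Real.pi) = W x := fun x => by
    simp only [hWdef, h₁, h₂]
    linear_combination (c * ψ₁ x ^ 2 + (d - a) * (ψ₁ x * ψ₂ x) - b * ψ₂ x ^ 2) * hdet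
  have hWc : Continuous W := by
    have c₁ := hb.fst.differentiable.continuous
    have c₂ := hb.snd.differentiable.continuous
    fun_prop
  have hsign : (∀ x, 0 < W x) ∨ ∀ x, W x < 0 := by
    by_contra! hcon
    obtain ⟨⟨x, hx⟩, y, hy⟩ := hcon
    obtain ⟨z, hz⟩ := mem_range_of_exists_le_of_exists_ge hWc ⟨x, hx⟩ ⟨y, hy⟩
    exact hW z hz
  rcases hsign with hpos | hneg
  · refine hb.transformsToConstant_of_quadratic hμ c (d - a) (-b) (fun x => ?_) (fun x => ?_)
    · have := hpos x
      simp only [hWdef] at this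
      linarith
    · have := hWper x
      simp only [hWdef] at this
      linarith
  · refine hb.transformsToConstant_of_quadratic hμ (-c) (-(d - a)) b (fun x => ?_) (fun x => ?_)
    · have := hneg x
      simp only [hWdef] at this
      linarith
    · have := hWper x
      simp only [hWdef] at this
      linarith

/-- If `M = ± 1` then `ψ₁² + ψ₂²` is periodic; if `|tr M| < 2` then a multiplier would be a real
root of `l² - (tr M) l + 1`. -/
theorem IsMonodromyMatrix.transformsToConstant_of_isElliptic {μ : ℝ → ℝ}
    {M : Matrix (Fin 2) (Fin 2) ℝ} (hM : IsMonodromyMatrix μ M) (hμ : ContDiff ℝ ∞ μ)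
    (h : IsEllipticMatrix M) : TransformsToConstant μ := by
  obtain ⟨ψ₁, ψ₂, hb, h₁, h₂⟩ := hM.exists_basis
  have hpos : ∀ x, 0 < 1 * ψ₁ x ^ 2 + 0 * (ψ₁ x * ψ₂ x) + 1 * ψ₂ x ^ 2 := by
    intro x
    by_contra hle
    have e₁ : ψ₁ x = 0 := by nlinarith [sq_nonneg (ψ₁ x), sq_nonneg (ψ₂ x)]
    have e₂ : ψ₂ x = 0 := by nlinarith [sq_nonneg (ψ₁ x), sq_nonneg (ψ₂ x)]
    have := hb.wronskian x
    rw [e₁, e₂] at this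
    simp at this
  rcases h with rfl | rfl | h
  · refine hb.transformsToConstant_of_quadratic hμ 1 0 1 hpos fun x => ?_
    simp [h₁, h₂]
  · refine hb.transformsToConstant_of_quadratic hμ 1 0 1 hpos fun x => ?_
    simp [h₁, h₂]
  · rcases hb.transformsToConstant_or_multiplicative hμ h₁ h₂ with h' | ⟨-, l, -, -, -, -, -, hl⟩
    · exact h'
    · rw [Matrix.trace_fin_two] at h
      obtain ⟨h3, h4⟩ := abs_lt.1 h
      nlinarith [sq_nonneg (l - 1), sq_nonneg (l + 1), sq_nonneg (l - (M 0 0 + M 1 1) / 2),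
        mul_pos (sub_pos.2 h4) (neg_lt_iff_pos_add.1 h3)]

/-! ### Transport of solutions along a diffeomorphism -/

/-- The density `ψ ↦ (f')^{-1/2} ψ ∘ f` of weight `-1/2` transports solutions for `μ` to
solutions for `μ_f`; here `s = √f'`, and the formula for the derivative gives the invariance of
the Wronskian. -/
theorem IsHillSolution.transport {μ f s s' s'' ψ : ℝ → ℝ} (hψ : IsHillSolution μ ψ)
    (hs : ∀ x, 0 < s x) (hf : ∀ x, HasDerivAt f (s x ^ 2) x)
    (hs' : ∀ x, HasDerivAt s (s' x) x) (hs'' : ∀ x, HasDerivAt s' (s'' x) x) :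
    IsHillSolution (transformedMassAspect μ f) (fun x => ψ (f x) / s x) ∧
      ∀ x, deriv (fun x => ψ (f x) / s x) x =
        deriv ψ (f x) * s x - ψ (f x) * s' x / s x ^ 2 := by
  have d₀ : ∀ x, HasDerivAt (fun x => ψ (f x) / s x)
      (deriv ψ (f x) * s x - ψ (f x) * s' x / s x ^ 2) x := fun x => by
    have hx := (hs x).ne'
    refine (((hψ.hasDerivAt (f x)).comp x (hf x)).div (hs' x) hx).congr_deriv ?_
    simp only [Function.comp]
    field_simp
  refine ⟨IsHillSolution.of_hasDerivAt d₀ fun x => ?_, fun x => (d₀ x).deriv⟩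
  have hx := (hs x).ne'
  have f₂ : ∀ x, HasDerivAt (fun x => s x ^ 2) (2 * s x * s' x) x := fun x =>
    ((hs' x).pow 2).congr_deriv (by ring)
  have f₃ : ∀ x, HasDerivAt (fun x => 2 * s x * s' x) (2 * s' x * s' x + 2 * s x * s'' x) x :=
    fun x => ((hs' x).const_mul 2).mul (hs'' x)
  have e := (((hψ.hasDerivAt_deriv (f x)).comp x (hf x)).mul (hs' x)).sub
    ((((hψ.hasDerivAt (f x)).comp x (hf x)).mul (hs'' x)).div (f₂ x) (pow_ne_zero 2 hx))
  refine e.congr_deriv ?_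
  rw [transformedMassAspect, schwarzian_eq_of_hasDerivAt hf f₂ f₃, (hf x).deriv]
  simp only [Function.comp, Pi.mul_apply]
  field_simp
  ring

theorem IsCircleDiffeo.exists_sqrt_deriv {f : ℝ → ℝ} (hf : IsCircleDiffeo f) :
    ∃ s s' s'' : ℝ → ℝ, (∀ x, 0 < s x) ∧ Function.Periodic s (2 * Real.pi) ∧
      (∀ x, HasDerivAt f (s x ^ 2) x) ∧
      (∀ x, HasDerivAt s (s' x) x) ∧ ∀ x, HasDerivAt s' (s'' x) x := by
  have hf' : ContDiff ℝ ∞ (deriv f) := (contDiff_infty_iff_deriv.1 hf.smooth).2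
  have hs : ContDiff ℝ ∞ fun x => √(deriv f x) := hf'.sqrt fun x => (hf.deriv_pos x).ne'
  have hs₁ := contDiff_infty_iff_deriv.1 hs
  have hs₂ := contDiff_infty_iff_deriv.1 hs₁.2
  refine ⟨fun x => √(deriv f x), _, _, fun x => Real.sqrt_pos.2 (hf.deriv_pos x), fun x => ?_,
    fun x => ?_, fun x => (hs₁.1 x).hasDerivAt, fun x => (hs₂.1 x).hasDerivAt⟩
  · simp only
    rw [← deriv_comp_add_const, funext hf.map_add, deriv_add_const]
  · simp only
    rw [Real.sq_sqrt (hf.deriv_pos x).le]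
    exact ((contDiff_infty_iff_deriv.1 hf.smooth).1 x).hasDerivAt

/-- Transport preserves normalised pairs. As the weight `s` is positive and periodic, it also
preserves the monodromy matrix and the property of having no zeros. -/
theorem IsHillBasis.transport {μ f ψ₁ ψ₂ : ℝ → ℝ} (hb : IsHillBasis μ ψ₁ ψ₂)
    (hf : IsCircleDiffeo f) : ∃ s : ℝ → ℝ, (∀ x, 0 < s x) ∧ Function.Periodic s (2 * Real.pi) ∧
      IsHillBasis (transformedMassAspect μ f) (fun x => ψ₁ (f x) / s x)
        (fun x => ψ₂ (f x) / s x) := by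
  obtain ⟨s, s', s'', hs, hper, hfs, hs', hs''⟩ := hf.exists_sqrt_deriv
  obtain ⟨t₁, e₁⟩ := hb.fst.transport hs hfs hs' hs''
  obtain ⟨t₂, e₂⟩ := hb.snd.transport hs hfs hs' hs''
  refine ⟨s, hs, hper, t₁, t₂, fun x => ?_⟩
  rw [e₁, e₂]
  have hx := (hs x).ne'
  field_simp
  linear_combination s x ^ 3 * hb.wronskian (f x)

theorem IsCircleDiffeo.surjective {f : ℝ → ℝ} (hf : IsCircleDiffeo f) :
    Function.Surjective f :=
  surjective_of_continuous_of_map_add Real.two_pi_pos hf.smooth.continuous hf.map_add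

/-! ### The equation with constant coefficient -/

theorem isHillSolution_exp (k : ℝ) :
    IsHillSolution (fun _ => 4 * k ^ 2) (fun x => Real.exp (k * x)) := by
  have h : ∀ x, HasDerivAt (fun x => Real.exp (k * x)) (k * Real.exp (k * x)) x := fun x =>
    (((hasDerivAt_id x).const_mul k).exp).congr_deriv (by simp [mul_comm])
  exact .of_hasDerivAt h fun x => ((h x).const_mul k).congr_deriv (by ring)

theorem isHillSolution_cos (k t : ℝ) :
    IsHillSolution (fun _ => -(4 * k ^ 2)) (fun x => Real.cos (k * x + t)) := by
  have hl : ∀ x, HasDerivAt (fun x => k * x + t) k x := fun x =>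
    (((hasDerivAt_id x).const_mul k).add_const t).congr_deriv (by simp)
  exact .of_hasDerivAt (fun x => (hl x).cos)
    fun x => ((hl x).sin.neg.mul_const k).congr_deriv (by ring)

/-- The monodromy of the constant negative equation is a rotation: it has trace `2 cos θ`, and
for `cos θ = ± 1` every solution is periodic or antiperiodic. -/
theorem IsHillBasis.isElliptic_of_const_neg {ψ₁ ψ₂ : ℝ → ℝ} {k : ℝ} (hk : k ≠ 0)
    (hb : IsHillBasis (fun _ => -(4 * k ^ 2)) ψ₁ ψ₂) {M : Matrix (Fin 2) (Fin 2) ℝ} {T : ℝ}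
    (h₁ : ∀ x, ψ₁ (x + T) = M 0 0 * ψ₁ x + M 0 1 * ψ₂ x)
    (h₂ : ∀ x, ψ₂ (x + T) = M 1 0 * ψ₁ x + M 1 1 * ψ₂ x) : IsEllipticMatrix M := by
  have htr : M.trace = 2 * Real.cos (k * T) := by
    have h := hb.translate_twice h₁ h₂ (isHillSolution_cos k 0) (-T)
    rw [Matrix.trace_fin_two]
    simp at h
    linarith
  by_cases hs : Real.sin (k * T) = 0
  · -- every solution is a combination of `cos (k x)` and `sin (k x) = cos (k x - π / 2)`
    have hform : ∀ ψ, IsHillSolution (fun _ => -(4 * k ^ 2)) ψ →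
        ∀ x, ψ (x + T) = Real.cos (k * T) * ψ x := by
      intro ψ hψ x
      have c₀ := isHillSolution_cos k 0
      have c₁ := isHillSolution_cos k (-(Real.pi / 2))
      have hbasis : IsHillBasis (fun _ => -(4 * k ^ 2))
          (fun x => 0 * Real.cos (k * x + 0) + k⁻¹ * Real.cos (k * x + -(Real.pi / 2)))
          (fun x => 1 * Real.cos (k * x + 0) + 0 * Real.cos (k * x + -(Real.pi / 2))) := by
        have d : ∀ t x, deriv (fun x => Real.cos (k * x + t)) x = -Real.sin (k * x + t) * k :=
          fun t x => ((((hasDerivAt_id x).const_mul k).add_const t).congr_deriv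
            (mul_one k)).cos.deriv
        refine ⟨c₀.combination c₁ _ _, c₀.combination c₁ _ _, fun x => ?_⟩
        rw [c₀.deriv_combination c₁, c₀.deriv_combination c₁, d, d]
        simp only [← sub_eq_add_neg, Real.sin_sub_pi_div_two, Real.cos_sub_pi_div_two, add_zero]
        field_simp
        nlinarith [Real.sin_sq_add_cos_sq (k * x)]
      obtain ⟨p, q, hpq⟩ := hbasis.exists_combination hψ
      simp only [hpq, mul_add k, add_zero, ← sub_eq_add_neg, Real.cos_sub_pi_div_two,
        Real.cos_add, Real.sin_add, hs]
      ring
    have hM : ∀ e : ℝ, Real.cos (k * T) = e → M = !![e, 0; 0, e] := by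
      intro e he
      have g₁ : ∀ x, (M 0 0 - e) * ψ₁ x + M 0 1 * ψ₂ x = 0 := fun x => by
        have := hform _ hb.fst x
        rw [h₁, he] at this
        linarith
      have g₂ : ∀ x, M 1 0 * ψ₁ x + (M 1 1 - e) * ψ₂ x = 0 := fun x => by
        have := hform _ hb.snd x
        rw [h₂, he] at this
        linarith
      have hz : ∀ p q : ℝ, (∀ x, p * ψ₁ x + q * ψ₂ x = 0) → p = 0 ∧ q = 0 := by
        intro p q h
        have h' := hb.fst.deriv_combination hb.snd p q 0
        rw [funext h, deriv_const] at h'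
        have hw := hb.wronskian 0
        constructor
        · linear_combination (-p) * hw - ψ₂ 0 * h' - deriv ψ₂ 0 * h 0
        · linear_combination (-q) * hw + ψ₁ 0 * h' + deriv ψ₁ 0 * h 0
      obtain ⟨a0, b0⟩ := hz _ _ g₁
      obtain ⟨c0, d0⟩ := hz _ _ g₂
      ext i j
      fin_cases i <;> fin_cases j <;> simp <;> linarith
    rcases Real.sin_eq_zero_iff_cos_eq.1 hs with h | h
    · left
      rw [hM 1 h, Matrix.one_fin_two]
    · right; left
      rw [hM (-1) h, Matrix.one_fin_two]
      simp
  · right; right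
    have h1 := Real.sin_sq_add_cos_sq (k * T)
    have h2 : 0 < Real.sin (k * T) ^ 2 := by positivity
    have h3 : |Real.cos (k * T)| < 1 := by
      rw [← sq_lt_one_iff_abs_lt_one]; linarith
    rw [htr, abs_mul, abs_two]
    linarith

/-- For constant coefficient `C` the monodromy is a rotation if `C < 0`, and an exponential is a
zero-free solution if `C ≥ 0`; both properties are transported back along `f`. -/
theorem IsMonodromyMatrix.isElliptic_or_exists_zeroFree {μ : ℝ → ℝ}
    {M : Matrix (Fin 2) (Fin 2) ℝ} (hM : IsMonodromyMatrix μ M) (h : TransformsToConstant μ) :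
    IsEllipticMatrix M ∨ ∃ ψ : ℝ → ℝ, IsHillSolution μ ψ ∧ ∀ x, ψ x ≠ 0 := by
  obtain ⟨f, hf, C, hC⟩ := h
  obtain ⟨ψ₁, ψ₂, hb, h₁, h₂⟩ := hM.exists_basis
  obtain ⟨s, hs, hper, ht⟩ := hb.transport hf
  rw [funext hC] at ht
  rcases lt_or_ge C 0 with hneg | hnn
  · left
    have hsq : (√(-C) / 2) ^ 2 = -C / 4 := by
      rw [div_pow, Real.sq_sqrt (by linarith)]; norm_num
    have hCk : C = -(4 * (√(-C) / 2) ^ 2) := by rw [hsq]; ring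
    have hk : √(-C) / 2 ≠ 0 := (div_pos (Real.sqrt_pos.2 (by linarith)) two_pos).ne'
    generalize √(-C) / 2 = k at hCk hk
    subst hCk
    refine ht.isElliptic_of_const_neg hk (T := 2 * Real.pi) (fun x => ?_) (fun x => ?_)
    · rw [hf.map_add, hper, h₁]; ring
    · rw [hf.map_add, hper, h₂]; ring
  · right
    have hCk : C = 4 * (√C / 2) ^ 2 := by
      rw [div_pow, Real.sq_sqrt hnn]; ring
    generalize √C / 2 = k at hCk
    subst hCk
    obtain ⟨p, q, hpq⟩ := ht.exists_combination (isHillSolution_exp k)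
    refine ⟨_, hb.fst.combination hb.snd p q, fun y => ?_⟩
    obtain ⟨x, rfl⟩ := hf.surjective y
    intro h0
    refine (Real.exp_pos (k * x)).ne' ?_
    rw [hpq]
    have : p * (ψ₁ (f x) / s x) + q * (ψ₂ (f x) / s x) =
      (p * ψ₁ (f x) + q * ψ₂ (f x)) / s x := by ring
    rw [this, h0, zero_div]

/-! ### The equivalence -/

/-- A zero-free solution has constant sign, so that Cayley–Hamilton
`ψ(x + 4π) + ψ(x) = (tr M) ψ(x + 2π)` forces a positive trace. -/
theorem IsMonodromyMatrix.trace_pos_of_zeroFree {μ ψ : ℝ → ℝ} {M : Matrix (Fin 2) (Fin 2) ℝ}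
    (hM : IsMonodromyMatrix μ M) (hψ : IsHillSolution μ ψ) (h0 : ∀ x, ψ x ≠ 0) :
    0 < M.trace := by
  obtain ⟨ψ₁, ψ₂, hb, h₁, h₂⟩ := hM.exists_basis
  have h := hb.translate_twice h₁ h₂ hψ 0
  rw [← Matrix.trace_fin_two] at h
  have hc := hψ.differentiable.continuous
  have hsign : (∀ x, 0 < ψ x) ∨ ∀ x, ψ x < 0 := by
    by_contra! hcon
    obtain ⟨hx, hy⟩ := hcon
    obtain ⟨z, hz⟩ := mem_range_of_exists_le_of_exists_ge hc hx hy
    exact h0 z hz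
  rcases hsign with hp | hn
  · refine pos_of_mul_pos_left (b := ψ (0 + 2 * Real.pi)) ?_ (hp _).le
    rw [← h]
    exact add_pos (hp _) (hp _)
  · by_contra hle
    have := mul_nonneg_of_nonpos_of_nonpos (not_lt.1 hle) (hn (0 + 2 * Real.pi)).le
    linarith [hn (0 + 2 * Real.pi + 2 * Real.pi), hn 0]

theorem mainTheorem2 (μ : ℝ → ℝ) (hμ : IsMassAspect μ)
    (M : Matrix (Fin 2) (Fin 2) ℝ) (hM : IsMonodromyMatrix μ M) :
    List.TFAE [
      TransformsToConstant μ,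
      IsEllipticMatrix M ∨
        ∃ ψ : ℝ → ℝ, IsHillSolution μ ψ ∧ ∀ I : Set ℝ, IsHalfClosedPeriod I → NoZerosOn ψ I,
      IsEllipticMatrix M ∨
        ∀ I : Set ℝ, IsHalfClosedPeriod I → ∃ ψ : ℝ → ℝ, IsHillSolution μ ψ ∧ NoZerosOn ψ I,
      IsEllipticMatrix M ∨
        (0 < M.trace ∧
          ∃ I : Set ℝ, IsHalfClosedPeriod I ∧
            ∃ ψ : ℝ → ℝ, IsHillSolution μ ψ ∧ NoZerosOn ψ I)] := by
  have hpi := Real.two_pi_pos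
  have hIco : ∀ a : ℝ, IsHalfClosedPeriod (Set.Ico a (a + 2 * Real.pi)) := fun a =>
    ⟨a, Or.inl rfl⟩
  tfae_have 1 → 2 := by
    intro h
    refine (hM.isElliptic_or_exists_zeroFree h).imp_right ?_
    rintro ⟨ψ, hψ, h0⟩
    exact ⟨ψ, hψ, fun I _ x _ => h0 x⟩
  tfae_have 2 → 3 := by
    refine Or.imp_right ?_
    rintro ⟨ψ, hψ, h0⟩ I hI
    exact ⟨ψ, hψ, h0 I hI⟩
  tfae_have 2 → 4 := by
    refine Or.imp_right ?_
    rintro ⟨ψ, hψ, h0⟩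
    refine ⟨hM.trace_pos_of_zeroFree hψ fun x => ?_, _, hIco 0, ψ, hψ, h0 _ (hIco 0)⟩
    exact h0 _ (hIco x) x ⟨le_rfl, by linarith⟩
  tfae_have 3 → 1 := by
    rintro (h | h)
    · exact hM.transformsToConstant_of_isElliptic hμ.smooth h
    obtain ⟨ψ₁, ψ₂, hb, h₁, h₂⟩ := hM.exists_basis
    rcases hb.transformsToConstant_or_multiplicative hμ.smooth h₁ h₂ with
      h' | ⟨φ, l, x₀, hφ, h0, hφ0, hl, -⟩
    · exact h'
    -- `φ` vanishes at both ends of `[x₀, x₀ + 2π)`, so that no solution is zero-free on it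
    obtain ⟨ψ, hψ, hne⟩ := h _ (hIco x₀)
    obtain ⟨x, hx, hx0⟩ := hφ.exists_zero_between hψ (a := x₀) (b := x₀ + 2 * Real.pi)
      (by linarith) h0 (by rw [hl, h0, mul_zero]) (hφ0 _ h0)
    exact absurd hx0 (hne x hx)
  tfae_have 4 → 1 := by
    rintro (h | ⟨htr, I, hI, ψ, hψ, hne⟩)
    · exact hM.transformsToConstant_of_isElliptic hμ.smooth h
    obtain ⟨ψ₁, ψ₂, hb, h₁, h₂⟩ := hM.exists_basis
    rcases hb.transformsToConstant_or_multiplicative hμ.smooth h₁ h₂ with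
      h' | ⟨φ, l, x₀, hφ, h0, hφ0, hl, hl2⟩
    · exact h'
    rw [← Matrix.trace_fin_two] at hl2
    have hlpos : 0 < l := pos_of_mul_pos_left (b := M.trace) (by rw [hl2]; positivity) htr.le
    obtain ⟨x, hx, hx0⟩ := hφ.exists_zero_mem_of_multiplier_pos hψ hlpos hl h0 hφ0 hI
    exact absurd hx0 (hne x hx)
  tfae_finish
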